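/- Let $\varphi:[0,\infty)\to[0,\infty)$ be an Orlicz function, i.e. $\varphi$ is convex, $\varphi(0)=0$ and $\varphi(t)>0$ for $t>0$; put $\varphi(\infty)=\infty$ and let $\varphi_*(v)=\sup\{uv-\varphi(u):0\le u<\infty\}\in[0,\infty]$ be its complementary function. (Function spaces.) Let $0<\gamma\le\infty$, let $I=[0,\gamma)$ carry Lebesgue measure $m$, and let $w$ be a positive, non-increasing function on $(0,\gamma)$ with $W(t)=\int_0^t w<\infty$ for all $t\in I$, and $\int_0^\infty w=\infty$ if $\gamma=\infty$. For a Lebesgue measurable $f:I\to\mathbb R$ let $f^*(t)=\inf\{s>0: m\{|f|>s\}\le t\}$ be its decreasing rearrangement (with $\inf\emptyset=\infty$), and for $\Phi\in\{\varphi,\varphi_*\}$ let $\rho_{\Phi,w}(f)=\int_I\Phi(f^*)\,w$. Let $\Lambda_{\varphi,w}$ be the set of all Lebesgue measurable $f:I\to\mathbb R$ with $\rho_{\varphi,w}(\lambda f)<\infty$ for some $\lambda>0$, and put $$\|f\|=\inf\{\epsilon>0:\rho_{\varphi,w}(f/\epsilon)\le1\},\qquad \|f\|^0=\sup\Big\{\int_I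 f^*g^*w:\ g \text{ measurable},\ \rho_{\varphi_*,w}(g)\le1\Big\},$$ $$\theta(f)=\inf\{\lambda>0:\rho_{\varphi,w}(f/\lambda)<\infty\}.$$ Then for every $f\in\Lambda_{\varphi,w}$, with $f_n=f\chi_{\{1/n\le|f|\le n\}}$ for $n\ge1$, the numbers $\theta(f)$, $\|f-f_n\|$ and $\|f-f_n\|^0$ are finite and $$\lim_{n\to\infty}\|f-f_n\|=\lim_{n\to\infty}\|f-f_n\|^0=\theta(f).$$ (Sequence spaces.) Let $w=(w(i))_{i\ge1}$ be a positive, non-increasing real sequence with $\sum_{i=1}^\infty w(i)=\infty$. For a real sequence $x=(x(i))_{i\ge1}$ let $x^*(i)=\inf\{s>0:|\{j:|x(j)|>s\}|<i\}$ (with $\inf\emptyset=\infty$) and $\alpha_{\Phi,w}(x)=\sum_{i=1}^\infty\Phi(x^*(i))w(i)$ for $\Phi\in\{\varphi,\varphi_*\}$. Let $\lambda_{\varphi,w}$ be the set of all real sequences $x$ with $\alpha_{\varphi,w}(\eta x)<\infty$ for some $\eta>0$, and put $\|x\|=\inf\{\epsilon>0:\alpha_{\varphi,w}(x/\epsilon)\le1\}$,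 $\|x\|^0=\sup\{\sum_{i=1}^\infty x^*(i)y^*(i)w(i):\alpha_{\varphi_*,w}(y)\le1\}$ and $\theta(x)=\inf\{\lambda>0:\alpha_{\varphi,w}(x/\lambda)<\infty\}$. Then for every $x\in\lambda_{\varphi,w}$, with $x_n=x\chi_{\{1,\dots,n\}}$ for $n\ge1$, the numbers $\theta(x)$, $\|x-x_n\|$ and $\|x-x_n\|^0$ are finite and $$\lim_{n\to\infty}\|x-x_n\|=\lim_{n\to\infty}\|x-x_n\|^0=\theta(x).$$ -/

import Mathlib

open Set Filter Topology MeasureTheory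
open scoped NNReal ENNReal

noncomputable section

namespace OrliczLorentz

/-- An Orlicz function on `[0, ∞)`: convex, zero at zero, and positive away from zero. -/
structure IsOrlicz (φ : ℝ≥0 → ℝ≥0) : Prop where
  convex : ConvexOn ℝ≥0 univ φ
  map_zero : φ 0 = 0
  pos : ∀ t, 0 < t → 0 < φ t

/-- An Orlicz function evaluated on `[0, ∞]`, with `φ(∞) = ∞`
(decreasing rearrangements may take the value `∞`). -/
def extend (φ : ℝ≥0 → ℝ≥0) (x : ℝ≥0∞) : ℝ≥0∞ :=
  if x = ⊤ then ⊤ else (φ x.toNNReal : ℝ≥0∞)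

/-- The complementary function `φ_*(v) = sup {u v - φ(u) : u ≥ 0}`, with values in `[0, ∞]`.
The truncation of the subtraction at `0` is harmless, since `u = 0` already gives the value `0`. -/
def complementary (φ : ℝ≥0 → ℝ≥0) (v : ℝ≥0∞) : ℝ≥0∞ :=
  ⨆ u : ℝ≥0, ((u : ℝ≥0∞) * v - (φ u : ℝ≥0∞))

/-- The distribution function `d_f(s) = μ {t : |f t| > s}`. -/
def distribution {α : Type*} [MeasurableSpace α] (μ : Measure α) (f : α → ℝ) (s : ℝ) : ℝ≥0∞ :=
  μ {t | s < |f t|}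

/-- The decreasing rearrangement `f^*(t) = inf {s > 0 : d_f(s) ≤ t}`, equal to `∞` if there is
no such `s`. -/
def rearrangement {α : Type*} [MeasurableSpace α] (μ : Measure α) (f : α → ℝ) (t : ℝ≥0∞) :
    ℝ≥0∞ :=
  ⨅ (s : ℝ) (_ : 0 < s) (_ : distribution μ f s ≤ t), ENNReal.ofReal s

/-- The interval `I = [0, γ)`, where `0 < γ ≤ ∞`. -/
def interval (γ : ℝ≥0∞) : Set ℝ := {t | 0 ≤ t ∧ ENNReal.ofReal t < γ}

/-- Lebesgue measure on `[0, γ)`. -/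
def intervalMeasure (γ : ℝ≥0∞) : Measure ℝ := volume.restrict (interval γ)

/-- A weight on `[0, γ)`: positive, decreasing (in the wide sense) and locally integrable, i.e.
`W(t) = ∫_0^t w < ∞` for `t ∈ [0, γ)`, with `W(∞) = ∞` if `γ = ∞`. The value at the single point
`0` plays no role, so that `w` may be unbounded near `0`. -/
structure IsWeight (γ : ℝ≥0∞) (w : ℝ → ℝ) : Prop where
  pos : ∀ t ∈ interval γ, 0 < t → 0 < w t
  anti : AntitoneOn w (interval γ ∩ Ioi 0)
  locInt : ∀ t ∈ interval γ, IntegrableOn w (Ioc 0 t)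
  total : γ = ⊤ → ∫⁻ t in Ioi (0 : ℝ), ENNReal.ofReal (w t) = ⊤

/-- A weight sequence: positive, decreasing (in the wide sense), with divergent sum. -/
structure IsSeqWeight (w : ℕ → ℝ) : Prop where
  pos : ∀ i, 0 < w i
  anti : Antitone w
  total : ∑' i, ENNReal.ofReal (w i) = ⊤

/-- The modular `ρ(f) = ∫_I Φ(f^*) w`; here `Φ` is `extend φ` or `complementary φ`. -/
def modular (Φ : ℝ≥0∞ → ℝ≥0∞) (γ : ℝ≥0∞) (w : ℝ → ℝ) (f : ℝ → ℝ) : ℝ≥0∞ :=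
  ∫⁻ t, Φ (rearrangement (intervalMeasure γ) f (ENNReal.ofReal t)) * ENNReal.ofReal (w t)
    ∂(intervalMeasure γ)

/-- The decreasing rearrangement of a sequence. Sequences are indexed from `0`, so the `i`-th term
here is the `(i+1)`-st term when counting from `1`, namely `inf {s > 0 : d_x(s) < i + 1}`;
see `seqRearrangement_eq`. -/
def seqRearrangement (x : ℕ → ℝ) (i : ℕ) : ℝ≥0∞ :=
  rearrangement Measure.count x (i : ℝ≥0∞)

theorem seqRearrangement_eq (x : ℕ → ℝ) (i : ℕ) :
    seqRearrangement x i =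
      ⨅ (s : ℝ) (_ : 0 < s) (_ : distribution Measure.count x s < (i : ℝ≥0∞) + 1),
        ENNReal.ofReal s := by
  have key : ∀ s : ℝ, distribution Measure.count x s ≤ (i : ℝ≥0∞) ↔
      distribution Measure.count x s < (i : ℝ≥0∞) + 1 := by
    intro s
    unfold distribution
    rw [Measure.count_apply (MeasurableSet.of_discrete)]
    generalize ({t | s < |x t|} : Set ℕ).encard = m
    induction m using ENat.recTopCoe with
    | top => simp
    | coe k =>
      simp only [ENat.toENNReal_coe]
      norm_cast
      exact Nat.lt_succ_iff.symm
  unfold seqRearrangement rearrangement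
  simp only [key]

/-- The modular `α(x) = ∑ Φ(x^*(i)) w(i)` of a sequence. -/
def seqModular (Φ : ℝ≥0∞ → ℝ≥0∞) (w : ℕ → ℝ) (x : ℕ → ℝ) : ℝ≥0∞ :=
  ∑' i, Φ (seqRearrangement x i) * ENNReal.ofReal (w i)

/-- The Luxemburg norm `inf {ε > 0 : ρ(f / ε) ≤ 1}` of a modular `ρ`. -/
def luxemburgNorm {α : Type*} (ρ : (α → ℝ) → ℝ≥0∞) (f : α → ℝ) : ℝ≥0∞ :=
  ⨅ (ε : ℝ) (_ : 0 < ε) (_ : ρ (fun t => f t / ε) ≤ 1), ENNReal.ofReal ε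

/-- `θ(f) = inf {l > 0 : ρ(f / l) < ∞}`. -/
def theta {α : Type*} (ρ : (α → ℝ) → ℝ≥0∞) (f : α → ℝ) : ℝ≥0∞ :=
  ⨅ (l : ℝ) (_ : 0 < l) (_ : ρ (fun t => f t / l) < ⊤), ENNReal.ofReal l

/-- The Orlicz-Lorentz function space `Λ_{φ,w}`: Lebesgue measurable `f` on `[0, γ)` with
`ρ(l f) < ∞` for some `l > 0`. (Values of `f` outside `[0, γ)` play no role.) -/
def functionSpace (φ : ℝ≥0 → ℝ≥0) (γ : ℝ≥0∞) (w : ℝ → ℝ) : Set (ℝ → ℝ) :=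
  {f | AEMeasurable f (intervalMeasure γ) ∧
    ∃ l : ℝ, 0 < l ∧ modular (extend φ) γ w (fun t => l * f t) < ⊤}

/-- The Orlicz-Lorentz sequence space `λ_{φ,w}`. -/
def sequenceSpace (φ : ℝ≥0 → ℝ≥0) (w : ℕ → ℝ) : Set (ℕ → ℝ) :=
  {x | ∃ l : ℝ, 0 < l ∧ seqModular (extend φ) w (fun i => l * x i) < ⊤}

/-- The Orlicz norm `‖f‖⁰ = sup {∫_I f^* g^* w : ρ_{φ_*,w}(g) ≤ 1}` over measurable `g`. -/
def orliczNorm (φ : ℝ≥0 → ℝ≥0) (γ : ℝ≥0∞) (w : ℝ → ℝ) (f : ℝ → ℝ) : ℝ≥0∞ :=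
  ⨆ (g : ℝ → ℝ) (_ : AEMeasurable g (intervalMeasure γ))
    (_ : modular (complementary φ) γ w g ≤ 1),
    ∫⁻ t, rearrangement (intervalMeasure γ) f (ENNReal.ofReal t) *
      rearrangement (intervalMeasure γ) g (ENNReal.ofReal t) * ENNReal.ofReal (w t)
      ∂(intervalMeasure γ)

/-- The Orlicz norm of a sequence, `‖x‖⁰ = sup {∑ x^*(i) y^*(i) w(i) : α_{φ_*,w}(y) ≤ 1}`. -/
def seqOrliczNorm (φ : ℝ≥0 → ℝ≥0) (w : ℕ → ℝ) (x : ℕ → ℝ) : ℝ≥0∞ :=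
  ⨆ (y : ℕ → ℝ) (_ : seqModular (complementary φ) w y ≤ 1),
    ∑' i, seqRearrangement x i * seqRearrangement y i * ENNReal.ofReal (w i)

/-- The truncation `f_n = f χ_{1/n ≤ |f| ≤ n}`, for `n ≥ 1`. -/
def truncation (f : ℝ → ℝ) (n : ℕ) : ℝ → ℝ :=
  indicator {t | 1 / (n : ℝ) ≤ |f t| ∧ |f t| ≤ n} f

/-- The restriction of a sequence to its first `n` terms. -/
def seqTruncation (x : ℕ → ℝ) (n : ℕ) : ℕ → ℝ :=
  indicator {i | i < n} x

end OrliczLorentz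

end

namespace OrliczLorentz

/-! ### Orlicz functions, complementary functions and Young's inequality -/

section OrliczFunction

variable {φ : ℝ≥0 → ℝ≥0}

/-! Let `h n` be `f` minus its truncation. Both limits come from the chain `θ(f) ≤ θ(h n) ≤ ‖h n‖ ≤
‖h n‖⁰ ≤ l (1 + ρ(h n / l))`, for `n ≥ 1` in the first inequality and for every `l > 0` in the last.

The removed part is bounded with support of finite measure. Hence `h n / l` of finite modular forces
the same for `f / l`: the rearrangement of `f` is controlled by a shift of that of `h n` away from
the origin, where the weight only helps, and by a constant near it (`theta_le_theta`). The second
inequality holds since a modular at most `1` is finite.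

The third inequality (`luxemburgNorm_le_orliczNorm`) tests the Orlicz norm against `p(u)`, where `p`
is a subgradient of `φ` and `u` is a bounded cut-off of `f^* / l`. Equality in Young's inequality
turns the bound on `∫ u p(u) w` into one on `∫ φ(u) w`, and monotone convergence removes the
cut-off.

The last inequality is Young's (`orliczNorm_le`). For admissible `l`, `ρ(h n / l)` tends to `0` by
dominated convergence: the rearrangements of `h n` tend to `0` and `φ(f^* / l) w` is an integrable
majorant. So the upper limit is at most every admissible `l`, hence at most `θ(f)`.

Functions and sequences are treated at once through `IsRearrangementScale`. -/

theorem IsOrlicz.map_mul_le (hφ : IsOrlicz φ) {a : ℝ≥0} (ha : a ≤ 1) (u : ℝ≥0) :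
    φ (a * u) ≤ a * φ u := by
  have h := hφ.convex.2 (mem_univ u) (mem_univ 0) (zero_le (a := a)) (zero_le (a := 1 - a))
    (add_tsub_cancel_of_le ha)
  simpa [hφ.map_zero] using h

theorem IsOrlicz.monotone (hφ : IsOrlicz φ) : Monotone φ := by
  intro a b hab
  rcases eq_or_ne b 0 with rfl | hb
  · simp_all
  have h1 : a / b ≤ 1 := div_le_one_of_le₀ hab (zero_le (a := b))
  have h := hφ.map_mul_le h1 b
  rw [div_mul_cancel₀ _ hb] at h
  exact h.trans (mul_le_of_le_one_left (zero_le (a := φ b)) h1)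

theorem extend_coe (φ : ℝ≥0 → ℝ≥0) (u : ℝ≥0) : extend φ u = φ u := by
  simp [extend]

theorem extend_top (φ : ℝ≥0 → ℝ≥0) : extend φ ⊤ = ⊤ := by
  simp [extend]

theorem extend_lt_top {x : ℝ≥0∞} (hx : x ≠ ⊤) : extend φ x < ⊤ := by
  simp [extend, hx]

theorem IsOrlicz.extend_mono (hφ : IsOrlicz φ) : Monotone (extend φ) := by
  intro x y hxy
  rcases eq_or_ne y ⊤ with rfl | hy
  · simp [extend_top]
  lift y to ℝ≥0 using hy
  lift x to ℝ≥0 using ne_top_of_le_ne_top ENNReal.coe_ne_top hxy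
  rw [extend_coe, extend_coe]
  exact_mod_cast hφ.monotone (by exact_mod_cast hxy)

theorem IsOrlicz.extend_pos (hφ : IsOrlicz φ) {x : ℝ≥0∞} (hx : x ≠ 0) : extend φ x ≠ 0 := by
  rcases eq_or_ne x ⊤ with rfl | hy
  · simp [extend_top]
  lift x to ℝ≥0 using hy
  rw [extend_coe]
  exact_mod_cast (hφ.pos x (pos_iff_ne_zero.2 (by exact_mod_cast hx))).ne'

theorem IsOrlicz.extend_tendsto_zero (hφ : IsOrlicz φ) : Tendsto (extend φ) (𝓝 0) (𝓝 0) := by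
  have h1 : Tendsto (fun x : ℝ≥0∞ => x * φ 1) (𝓝 0) (𝓝 0) := by
    simpa using ENNReal.Tendsto.mul_const (b := (φ 1 : ℝ≥0∞)) (tendsto_id (x := 𝓝 (0 : ℝ≥0∞)))
      (Or.inr ENNReal.coe_ne_top)
  refine tendsto_of_tendsto_of_tendsto_of_le_of_le' tendsto_const_nhds h1
    (Eventually.of_forall fun _ => zero_le) ?_
  filter_upwards [Iio_mem_nhds (zero_lt_one (α := ℝ≥0∞))] with x hx
  lift x to ℝ≥0 using (hx.trans ENNReal.one_lt_top).ne
  have hx' : x ≤ 1 := by exact_mod_cast (mem_Iio.1 hx).le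
  rw [extend_coe]
  exact_mod_cast (by simpa using hφ.map_mul_le hx' 1 : φ x ≤ x * φ 1)

theorem complementary_mono (φ : ℝ≥0 → ℝ≥0) : Monotone (complementary φ) := fun _ _ h =>
  iSup_mono fun _ => tsub_le_tsub_right (by gcongr) _

theorem complementary_mul_le (φ : ℝ≥0 → ℝ≥0) {a : ℝ≥0∞} (ha : a ≤ 1) (v : ℝ≥0∞) :
    complementary φ (a * v) ≤ a * complementary φ v := by
  have ha' : a ≠ ⊤ := ne_top_of_le_ne_top ENNReal.one_ne_top ha
  refine iSup_le fun u => ?_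
  calc (u : ℝ≥0∞) * (a * v) - φ u ≤ a * (u * v) - a * φ u := by
        rw [mul_left_comm]
        exact tsub_le_tsub_left (mul_le_of_le_one_left zero_le ha) _
    _ = a * (u * v - φ u) := by
        rw [ENNReal.mul_sub fun _ _ => ha']
    _ ≤ _ := by
        gcongr
        exact le_iSup (fun u : ℝ≥0 => (u : ℝ≥0∞) * v - φ u) u

/-- Young's inequality. -/
theorem mul_le_extend_add (φ : ℝ≥0 → ℝ≥0) (u v : ℝ≥0∞) :
    u * v ≤ extend φ u + complementary φ v := by
  rcases eq_or_ne u ⊤ with rfl | hu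
  · simp [extend_top]
  lift u to ℝ≥0 using hu
  rw [extend_coe, ← tsub_le_iff_left]
  exact le_iSup (fun u : ℝ≥0 => (u : ℝ≥0∞) * v - φ u) u

/-- Extending `φ` by `0` to the negative axis makes every `u ≥ 0`, including `0`, an interior point,
so that one-sided derivatives are available there. Convexity survives because the positive part is
convex and `φ` is monotone. -/
theorem IsOrlicz.convexOn_real (hφ : IsOrlicz φ) :
    ConvexOn ℝ univ (fun x : ℝ => (φ x.toNNReal : ℝ)) := by
  refine ⟨convex_univ, fun x _ y _ a b ha hb hab => ?_⟩
  lift a to ℝ≥0 using ha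
  lift b to ℝ≥0 using hb
  have h1 : ((a : ℝ) • x + (b : ℝ) • y).toNNReal ≤ a • x.toNNReal + b • y.toNNReal := by
    refine Real.toNNReal_le_iff_le_coe.2 ?_
    push_cast [smul_eq_mul, NNReal.smul_def]
    have := Real.le_coe_toNNReal x
    have := Real.le_coe_toNNReal y
    gcongr
  have h2 := (hφ.monotone h1).trans (hφ.convex.2 (mem_univ x.toNNReal) (mem_univ y.toNNReal)
    (zero_le (a := a)) (zero_le (a := b)) (by exact_mod_cast hab))
  exact_mod_cast h2

/-- A monotone selection of subgradients gives equality in Young's inequality. -/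
theorem IsOrlicz.exists_subgradient (hφ : IsOrlicz φ) :
    ∃ p : ℝ≥0 → ℝ≥0, Monotone p ∧
      ∀ u : ℝ≥0, (φ u : ℝ≥0∞) + complementary φ (p u) ≤ u * p u := by
  set F : ℝ → ℝ := fun x => (φ x.toNNReal : ℝ) with hF
  have hc : ConvexOn ℝ univ F := hφ.convexOn_real
  have hmono : Monotone F := fun x y h => by
    simpa [hF] using hφ.monotone (Real.toNNReal_mono h)
  -- The right derivative of a convex function is a subgradient and is monotone.
  set q : ℝ → ℝ := fun x => derivWithin F (Ioi x) x with hq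
  have hi : ∀ x : ℝ, x ∈ interior (univ : Set ℝ) := fun x => by simp
  have hqm : Monotone q := by
    have := hc.monotoneOn_rightDeriv
    rwa [interior_univ, monotoneOn_univ] at this
  have hsub : ∀ x y : ℝ, F x + q x * (y - x) ≤ F y := by
    intro x y
    rcases lt_trichotomy x y with h | rfl | h
    · have := hc.rightDeriv_le_slope_of_mem_interior (hi x) (mem_univ y) h
      rw [slope_def_field, le_div_iff₀ (by linarith)] at this
      simp only [hq]; linarith
    · simp
    · have := (hc.slope_le_leftDeriv_of_mem_interior (mem_univ y) (hi x) h).trans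
        (hc.leftDeriv_le_rightDeriv_of_mem_interior (hi x))
      rw [slope_def_field, div_le_iff₀ (by linarith)] at this
      simp only [hq]; linarith
  have hq0 : ∀ x, 0 ≤ q x := fun x => by
    have h1 := hsub x (x - 1)
    have h2 := hmono (show x - 1 ≤ x by linarith)
    linarith
  refine ⟨fun u => (q u).toNNReal, fun u v h => Real.toNNReal_mono (hqm (by exact_mod_cast h)), ?_⟩
  intro u
  simp only [complementary]
  rw [ENNReal.add_iSup]
  refine iSup_le fun v => ?_
  have key : φ u + v * (q u).toNNReal ≤ u * (q u).toNNReal + φ v := by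
    rw [← NNReal.coe_le_coe]
    push_cast
    rw [Real.coe_toNNReal _ (hq0 _)]
    have := hsub u v
    simp only [hF, Real.toNNReal_coe] at this
    linarith
  -- The truncated subtraction in `complementary` needs this separately: it covers those `v` for
  -- which the difference is cut off at `0`.
  have key0 : φ u ≤ u * (q u).toNNReal := by
    rw [← NNReal.coe_le_coe]
    push_cast
    rw [Real.coe_toNNReal _ (hq0 _)]
    have := hsub u 0
    simp only [hF, Real.toNNReal_coe, Real.toNNReal_zero, hφ.map_zero] at this
    push_cast at this
    linarith
  have e : ∀ a b c d : ℝ≥0, a + b ≤ c + d → a ≤ c → a + (b - d) ≤ c := by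
    intro a b c d h1 h2
    rcases le_total b d with h | h
    · simpa [tsub_eq_zero_of_le h] using h2
    · rw [← add_tsub_assoc_of_le h]; exact tsub_le_iff_right.2 h1
  exact_mod_cast e _ _ _ _ key key0

/-- Only `x = ∞` has content: `φ` is unbounded, because convexity and `φ 0 = 0` give `φ (n + 1) ≥ (n
+ 1) φ 1`. -/
theorem IsOrlicz.iSup_extend_min (hφ : IsOrlicz φ) (x : ℝ≥0∞) :
    extend φ x ≤ ⨆ k : ℕ, extend φ (min x k) := by
  rcases eq_or_ne x ⊤ with rfl | hx
  · rw [extend_top, top_le_iff, iSup_eq_top]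
    intro b hb
    have h1 := hφ.pos 1 one_pos
    obtain ⟨n, hn⟩ := ENNReal.exists_nat_mul_gt (a := (φ 1 : ℝ≥0∞)) (b := b)
      (by exact_mod_cast h1.ne') hb.ne
    refine ⟨n + 1, hn.trans_le ?_⟩
    have h2 := hφ.map_mul_le (a := ((n : ℝ≥0) + 1)⁻¹) (by simp) (n + 1)
    rw [inv_mul_cancel₀ (by positivity)] at h2
    rw [← mul_le_mul_iff_right₀ (a := (n : ℝ≥0) + 1) (by positivity), ← mul_assoc,
      mul_inv_cancel₀ (by positivity), one_mul] at h2
    have h3 : (n : ℝ≥0) * φ 1 ≤ φ ((n + 1 : ℕ) : ℝ≥0) := by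
      push_cast
      exact (mul_le_mul_left (le_add_of_nonneg_right zero_le_one) _).trans h2
    rw [min_eq_right le_top]
    calc (n : ℝ≥0∞) * φ 1 ≤ φ ((n + 1 : ℕ) : ℝ≥0) := by exact_mod_cast h3
      _ = extend φ ((n + 1 : ℕ) : ℝ≥0∞) := by rw [← extend_coe]; norm_cast
  · obtain ⟨k, hk⟩ := ENNReal.exists_nat_gt hx
    refine le_iSup_of_le k ?_
    rw [min_eq_left hk.le]

end OrliczFunction

/-! ### Decreasing rearrangements -/

section Rearrangement

variable {α : Type*} [MeasurableSpace α] {μ : Measure α}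

theorem distribution_anti (μ : Measure α) (f : α → ℝ) : Antitone (distribution μ f) :=
  fun _ _ h => measure_mono fun _ ht => lt_of_le_of_lt h ht

theorem rearrangement_anti (μ : Measure α) (f : α → ℝ) : Antitone (rearrangement μ f) := by
  intro a b hab
  refine iInf_mono fun s => iInf_mono fun hs => ?_
  exact iInf_mono' fun h => ⟨h.trans hab, le_rfl⟩

theorem rearrangement_le {f : α → ℝ} {s : ℝ} {t : ℝ≥0∞} (hs : 0 ≤ s)
    (h : distribution μ f s ≤ t) : rearrangement μ f t ≤ ENNReal.ofReal s := by
  -- The infimum runs over positive levels only, so `s = 0` has to be approached from above.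
  refine le_of_forall_gt_imp_ge_of_dense fun b hb => ?_
  rcases eq_or_ne b ⊤ with rfl | hb'
  · exact le_top
  lift b to ℝ≥0 using hb'
  have hsb : s < b := by
    rw [ENNReal.ofReal_lt_iff_lt_toReal hs ENNReal.coe_ne_top] at hb
    simpa using hb
  refine iInf_le_of_le (b : ℝ) (iInf_le_of_le (hs.trans_lt hsb)
    (iInf_le_of_le ((distribution_anti μ f hsb.le).trans h) ?_))
  simp

theorem le_rearrangement {f : α → ℝ} {s : ℝ} {t : ℝ≥0∞}
    (h : t < distribution μ f s) : ENNReal.ofReal s ≤ rearrangement μ f t := by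
  refine le_iInf fun s' => le_iInf fun _ => le_iInf fun hd => ?_
  refine ENNReal.ofReal_le_ofReal ?_
  by_contra! hlt
  exact (h.trans_le ((distribution_anti μ f hlt.le).trans hd)).false

theorem rearrangement_mono {f g : α → ℝ} (h : ∀ t, |f t| ≤ |g t|) (t : ℝ≥0∞) :
    rearrangement μ f t ≤ rearrangement μ g t := by
  refine iInf_mono fun s => iInf_mono fun hs => ?_
  refine iInf_mono' fun hd => ⟨le_trans (measure_mono fun x hx => ?_) hd, le_rfl⟩
  exact lt_of_lt_of_le hx (h x)

theorem rearrangement_div {f : α → ℝ} {c : ℝ} (hc : 0 < c) (t : ℝ≥0∞) :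
    rearrangement μ (fun x => f x / c) t = rearrangement μ f t / ENNReal.ofReal c := by
  have hd : ∀ s, distribution μ (fun x => f x / c) s = distribution μ f (s * c) := fun s => by
    simp only [distribution, abs_div, abs_of_pos hc, lt_div_iff₀ hc]
  apply le_antisymm
  · rw [ENNReal.le_div_iff_mul_le (Or.inl (by simpa using hc)) (Or.inl ENNReal.ofReal_ne_top)]
    refine le_iInf fun s => le_iInf fun hs => le_iInf fun h => ?_
    rw [← ENNReal.le_div_iff_mul_le (Or.inl (by simpa using hc)) (Or.inl ENNReal.ofReal_ne_top),
      ← ENNReal.ofReal_div_of_pos hc]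
    refine rearrangement_le (by positivity) ?_
    rwa [hd, div_mul_cancel₀ _ hc.ne']
  · refine le_iInf fun s => le_iInf fun hs => le_iInf fun h => ?_
    rw [ENNReal.div_le_iff_le_mul (Or.inl (by simpa using hc)) (Or.inl ENNReal.ofReal_ne_top),
      ← ENNReal.ofReal_mul hs.le]
    exact rearrangement_le (by positivity) (by rwa [hd] at h)

/-- If `d_f ≤ d_g + c`, then `f^*(t + c) ≤ g^*(t)`. -/
theorem rearrangement_add_le {f g : α → ℝ} {c : ℝ≥0∞}
    (h : ∀ s, 0 < s → distribution μ f s ≤ distribution μ g s + c) (t : ℝ≥0∞) :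
    rearrangement μ f (t + c) ≤ rearrangement μ g t := by
  refine iInf_mono fun s => iInf_mono fun hs => iInf_mono' fun hd => ⟨?_, le_rfl⟩
  exact (h s hs).trans (by gcongr)

/-- If `d_f ≤ d_g` on `[M, ∞)`, then `f^* ≤ max g^* M`. -/
theorem rearrangement_le_max {f g : α → ℝ} {M : ℝ} (hM : 0 ≤ M)
    (h : ∀ s, M ≤ s → distribution μ f s ≤ distribution μ g s) (t : ℝ≥0∞) :
    rearrangement μ f t ≤ max (rearrangement μ g t) (ENNReal.ofReal M) := by
  by_cases hd : rearrangement μ f t ≤ ENNReal.ofReal M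
  · exact hd.trans (le_max_right _ _)
  refine le_trans (le_iInf fun s => le_iInf fun hs => le_iInf fun hg => ?_) (le_max_left _ _)
  have h1 : rearrangement μ f t ≤ ENNReal.ofReal (max s M) :=
    rearrangement_le (hM.trans (le_max_right _ _))
      ((h _ (le_max_right _ _)).trans ((distribution_anti μ g (le_max_left _ _)).trans hg))
  rw [ENNReal.ofReal_max, le_max_iff] at h1
  exact h1.resolve_right hd

end Rearrangement

end OrliczLorentz

noncomputable section

namespace OrliczLorentz

/-! ### The common argument for intervals and sequences -/

section Abstract

theorem theta_le_luxemburgNorm {β : Type*} (ρ : (β → ℝ) → ℝ≥0∞) (f : β → ℝ) :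
    theta ρ f ≤ luxemburgNorm ρ f :=
  iInf_mono fun _ => iInf_mono fun _ => iInf_mono' fun h =>
    ⟨h.trans_lt ENNReal.one_lt_top, le_rfl⟩

variable {α : Type*} [MeasurableSpace α]

/-- The properties of the index map `τ : α → [0, ∞)` and of the weight `w` that are shared by
intervals and by sequences, where `α` is respectively `[0, γ)` and `ℕ`. -/
structure IsRearrangementScale (μ : Measure α) (τ : α → ℝ≥0∞) (w : α → ℝ≥0∞) : Prop where
  measurable_index : Measurable τ
  index_ne_top : ∀ t, τ t ≠ ⊤
  weight_ne_top : ∀ t, w t ≠ ⊤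
  aemeasurable_weight : AEMeasurable w μ
  total : μ univ = ⊤ → ∫⁻ t, w t ∂μ = ⊤
  head : ∀ c : ℝ≥0∞, c ≠ ⊤ → ∫⁻ t in {t | τ t ≤ c}, w t ∂μ < ⊤
  -- Translation by `c` together with monotonicity of the weight: moving mass towards the origin
  -- only increases the weight.
  tail : ∀ (c : ℝ≥0∞) (F G : ℝ≥0∞ → ℝ≥0∞), c ≠ ⊤ → Antitone F → Antitone G →
    (∀ t, F (t + c) ≤ G t) →
      ∫⁻ t in {t | c < τ t}, F (τ t) * w t ∂μ ≤ ∫⁻ t, G (τ t) * w t ∂μ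
  -- Almost everywhere only: a rearrangement is right-continuous, while `G` may jump arbitrarily.
  realize : ∀ G : ℝ≥0∞ → ℝ≥0, Antitone G → ∃ g : α → ℝ, AEMeasurable g μ ∧
    ∀ᵐ t ∂μ, rearrangement μ g (τ t) = G (τ t)

/-- The modular `∫ Φ(f^* ∘ τ) w`. -/
def scaleModular (Φ : ℝ≥0∞ → ℝ≥0∞) (μ : Measure α) (τ : α → ℝ≥0∞) (w : α → ℝ≥0∞) (f : α → ℝ) :
    ℝ≥0∞ :=
  ∫⁻ t, Φ (rearrangement μ f (τ t)) * w t ∂μ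

/-- The Orlicz norm `sup {∫ (f^* ∘ τ) (g^* ∘ τ) w : ∫ φ_*(g^* ∘ τ) w ≤ 1}`. -/
def scaleOrliczNorm (φ : ℝ≥0 → ℝ≥0) (μ : Measure α) (τ : α → ℝ≥0∞) (w : α → ℝ≥0∞) (f : α → ℝ) :
    ℝ≥0∞ :=
  ⨆ (g : α → ℝ) (_ : AEMeasurable g μ) (_ : scaleModular (complementary φ) μ τ w g ≤ 1),
    ∫⁻ t, rearrangement μ f (τ t) * rearrangement μ g (τ t) * w t ∂μ

variable {φ : ℝ≥0 → ℝ≥0} {μ : Measure α} {τ w : α → ℝ≥0∞}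

theorem scaleModular_mono {Φ : ℝ≥0∞ → ℝ≥0∞} (hΦ : Monotone Φ) {f g : α → ℝ}
    (h : ∀ t, |f t| ≤ |g t|) : scaleModular Φ μ τ w f ≤ scaleModular Φ μ τ w g := by
  refine lintegral_mono fun t => ?_
  dsimp only
  gcongr
  exact hΦ (rearrangement_mono h _)

namespace IsRearrangementScale

theorem aemeasurable_mul (S : IsRearrangementScale μ τ w) {F : ℝ≥0∞ → ℝ≥0∞} (hF : Antitone F) :
    AEMeasurable (fun t => F (τ t) * w t) μ :=
  (hF.measurable.comp S.measurable_index).aemeasurable.mul S.aemeasurable_weight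

theorem aemeasurable_modular (S : IsRearrangementScale μ τ w) {Φ : ℝ≥0∞ → ℝ≥0∞} (hΦ : Monotone Φ)
    (f : α → ℝ) : AEMeasurable (fun t => Φ (rearrangement μ f (τ t)) * w t) μ :=
  S.aemeasurable_mul (hΦ.comp_antitone (rearrangement_anti μ f))

/-- An infinite level set at height `s` forces `f^* ≥ s` at all finite indices, and the modular is
then at least `φ(s) ∫ w = ∞`. -/
theorem distribution_lt_top (S : IsRearrangementScale μ τ w) (hφ : IsOrlicz φ) {f : α → ℝ}
    (h : scaleModular (extend φ) μ τ w f < ⊤) {s : ℝ} (hs : 0 < s) :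
    distribution μ f s < ⊤ := by
  by_contra htop
  rw [not_lt, top_le_iff] at htop
  have hμ : μ univ = ⊤ := top_le_iff.1 (htop.ge.trans (measure_mono (subset_univ _)))
  have hpos : extend φ (ENNReal.ofReal s) ≠ 0 := hφ.extend_pos (by simpa using hs)
  have h1 : extend φ (ENNReal.ofReal s) * ∫⁻ t, w t ∂μ ≤ scaleModular (extend φ) μ τ w f := by
    rw [← lintegral_const_mul' _ _ (extend_lt_top ENNReal.ofReal_ne_top).ne]
    refine lintegral_mono fun t => ?_
    dsimp only
    gcongr
    refine hφ.extend_mono (le_rearrangement ?_)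
    rw [htop]
    exact (S.index_ne_top t).lt_top
  rw [S.total hμ, ENNReal.mul_top hpos] at h1
  exact (h1.trans_lt h).false

/-- The finiteness of the modular is not affected by a bounded perturbation of finite support. -/
theorem modular_lt_top_of_distribution_le (S : IsRearrangementScale μ τ w) (hφ : IsOrlicz φ)
    {f g : α → ℝ} {c : ℝ≥0∞} {M : ℝ} (hc : c ≠ ⊤) (hM : 0 ≤ M)
    (h1 : ∀ s, 0 < s → distribution μ f s ≤ distribution μ g s + c)
    (h2 : ∀ s, M ≤ s → distribution μ f s ≤ distribution μ g s)
    {l : ℝ} (hl : 0 < l) (hg : scaleModular (extend φ) μ τ w (fun t => g t / l) < ⊤) :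
    scaleModular (extend φ) μ τ w (fun t => f t / l) < ⊤ := by
  simp only [scaleModular, rearrangement_div hl] at hg ⊢
  set F : ℝ≥0∞ → ℝ≥0∞ := fun t => extend φ (rearrangement μ f t / ENNReal.ofReal l) with hF
  set G : ℝ≥0∞ → ℝ≥0∞ := fun t => extend φ (rearrangement μ g t / ENNReal.ofReal l) with hG
  set K : ℝ≥0∞ := extend φ (ENNReal.ofReal M / ENNReal.ofReal l) with hK
  have hdiv : Monotone fun x : ℝ≥0∞ => extend φ (x / ENNReal.ofReal l) := fun x y h =>
    hφ.extend_mono (ENNReal.div_le_div_right h _)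
  have hFa : Antitone F := hdiv.comp_antitone (rearrangement_anti μ f)
  have hGa : Antitone G := hdiv.comp_antitone (rearrangement_anti μ g)
  have hKt : K ≠ ⊤ :=
    (extend_lt_top (ENNReal.div_ne_top ENNReal.ofReal_ne_top (by simpa using hl))).ne
  have hFG : ∀ t, F t ≤ G t + K := fun t => by
    refine (hdiv (rearrangement_le_max hM h2 t)).trans ?_
    refine le_trans (le_of_eq hdiv.map_max) ?_
    exact max_le (le_self_add) (le_add_self)
  have hset : MeasurableSet {t | τ t ≤ c} := S.measurable_index measurableSet_Iic
  have hcompl : {t | τ t ≤ c}ᶜ = {t | c < τ t} := by ext; simp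
  change ∫⁻ t, F (τ t) * w t ∂μ < ⊤
  -- Indices beyond `c` are handled by the shift. The head carries finite weight, and there `F ≤ G +
  -- K` suffices.
  rw [← lintegral_add_compl _ hset, hcompl, ENNReal.add_lt_top]
  refine ⟨?_, (S.tail c F G hc hFa hGa fun t =>
    hdiv (rearrangement_add_le h1 t)).trans_lt hg⟩
  calc ∫⁻ t in {t | τ t ≤ c}, F (τ t) * w t ∂μ
      ≤ ∫⁻ t in {t | τ t ≤ c}, G (τ t) * w t + K * w t ∂μ := by
        refine lintegral_mono fun t => ?_
        dsimp only
        rw [← add_mul]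
        gcongr
        exact hFG _
    _ = ∫⁻ t in {t | τ t ≤ c}, G (τ t) * w t ∂μ + K * ∫⁻ t in {t | τ t ≤ c}, w t ∂μ := by
        rw [lintegral_add_left' (S.aemeasurable_mul hGa).restrict, lintegral_const_mul' _ _ hKt]
    _ < ⊤ := ENNReal.add_lt_top.2 ⟨(setLIntegral_le_lintegral _ _).trans_lt hg,
        ENNReal.mul_lt_top hKt.lt_top (S.head c hc)⟩

theorem theta_le_theta (S : IsRearrangementScale μ τ w) (hφ : IsOrlicz φ)
    {f g : α → ℝ} {c : ℝ≥0∞} {M : ℝ} (hc : c ≠ ⊤) (hM : 0 ≤ M)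
    (h1 : ∀ s, 0 < s → distribution μ f s ≤ distribution μ g s + c)
    (h2 : ∀ s, M ≤ s → distribution μ f s ≤ distribution μ g s) :
    theta (scaleModular (extend φ) μ τ w) f ≤ theta (scaleModular (extend φ) μ τ w) g :=
  iInf_mono fun _ => iInf_mono fun hl => iInf_mono' fun hg =>
    ⟨S.modular_lt_top_of_distribution_le hφ hc hM h1 h2 hl hg, le_rfl⟩

/-- The Orlicz norm is at most `l (1 + ρ(f / l))`. -/
theorem orliczNorm_le (S : IsRearrangementScale μ τ w) (hφ : IsOrlicz φ) (f : α → ℝ) {l : ℝ}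
    (hl : 0 < l) :
    scaleOrliczNorm φ μ τ w f ≤
      ENNReal.ofReal l * (scaleModular (extend φ) μ τ w (fun t => f t / l) + 1) := by
  refine iSup_le fun g => iSup_le fun _ => iSup_le fun hg => ?_
  calc ∫⁻ t, rearrangement μ f (τ t) * rearrangement μ g (τ t) * w t ∂μ
      ≤ ∫⁻ t, ENNReal.ofReal l * (extend φ (rearrangement μ (fun t => f t / l) (τ t)) * w t +
          complementary φ (rearrangement μ g (τ t)) * w t) ∂μ := by
        refine lintegral_mono fun t => ?_
        dsimp only
        rw [← add_mul, ← mul_assoc]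
        refine mul_le_mul_left ?_ _
        refine le_trans (le_of_eq ?_) (mul_le_mul_right (mul_le_extend_add φ _ _) _)
        rw [rearrangement_div hl, ← mul_assoc,
          ENNReal.mul_div_cancel (by simpa using hl) ENNReal.ofReal_ne_top]
    _ = ENNReal.ofReal l * (scaleModular (extend φ) μ τ w (fun t => f t / l) +
          scaleModular (complementary φ) μ τ w g) := by
        rw [lintegral_const_mul' _ _ ENNReal.ofReal_ne_top,
          lintegral_add_left' (S.aemeasurable_modular hφ.extend_mono _)]
        rfl
    _ ≤ _ := by gcongr

/-- A bounded decreasing function of bounded support that lies below `f^* / l` has modular at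
most `1`, if the Orlicz norm of `f` is at most `l`. -/
theorem lintegral_extend_le_one (S : IsRearrangementScale μ τ w) (hφ : IsOrlicz φ) {f : α → ℝ}
    {l : ℝ≥0} (hl : l ≠ 0) (hf : scaleOrliczNorm φ μ τ w f ≤ l) {u : ℝ≥0∞ → ℝ≥0}
    (hu : Antitone u) {c : ℝ≥0∞} (hc : c ≠ ⊤) (hsupp : ∀ t, c < t → u t = 0)
    (huf : ∀ t, (l : ℝ≥0∞) * u t ≤ rearrangement μ f t) :
    ∫⁻ t, φ (u (τ t)) * w t ∂μ ≤ 1 := by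
  obtain ⟨p, hp, hpY⟩ := hφ.exists_subgradient
  obtain ⟨g, hgm, hg⟩ := S.realize (fun t => p (u t)) (hp.comp_antitone hu)
  -- Finiteness of `A` is the reason for cutting off `u`: `A` is cancelled at the end.
  set A : ℝ≥0∞ := ∫⁻ t, complementary φ (p (u (τ t))) * w t ∂μ with hA
  have hcm : Antitone fun t => complementary φ (p (u t)) :=
    (complementary_mono φ).comp_antitone
      (ENNReal.coe_mono.comp_antitone (hp.comp_antitone hu))
  have hAt : A ≠ ⊤ := by
    have h1 : A ≤ ∫⁻ t, {t | τ t ≤ c}.indicator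
        (fun t => ((u 0 * p (u 0) : ℝ≥0) : ℝ≥0∞) * w t) t ∂μ := by
      refine lintegral_mono fun t => ?_
      by_cases ht : τ t ≤ c
      · rw [indicator_of_mem (by exact ht)]
        dsimp only
        gcongr
        refine (le_add_self.trans (hpY _)).trans ?_
        push_cast
        have h0 : u (τ t) ≤ u 0 := hu zero_le
        gcongr
        exact hp h0
      · rw [indicator_of_notMem (by exact ht), hsupp _ (not_le.1 ht)]
        -- `p 0` may be positive, so the test function need not vanish off the support of `u`; but
        -- equality in Young's inequality at `0` gives `φ_*(p 0) = 0`.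
        have := le_add_self.trans (hpY 0)
        simp only [ENNReal.coe_zero, zero_mul] at this
        simp [le_antisymm this zero_le]
    rw [lintegral_indicator (show MeasurableSet {t | τ t ≤ c} from
        S.measurable_index measurableSet_Iic),
      lintegral_const_mul' _ _ ENNReal.coe_ne_top] at h1
    exact (h1.trans_lt (ENNReal.mul_lt_top ENNReal.coe_lt_top (S.head c hc))).ne
  -- `C ≥ 1` allows `φ_*(v / C) ≤ φ_*(v) / C`, and `C ≥ A` then makes `g / C` admissible. The bound
  -- `C ≤ 1 + A` is what closes the estimate.
  set C : ℝ≥0 := max 1 A.toNNReal with hC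
  have hC1 : 1 ≤ C := le_max_left _ _
  have hC0 : 0 < C := one_pos.trans_le hC1
  have hAC : A ≤ C := by
    rw [← ENNReal.coe_toNNReal hAt]
    exact_mod_cast le_max_right _ _
  have hg' : ∀ᵐ t ∂μ, rearrangement μ (fun t => g t / (C : ℝ)) (τ t) =
      (C : ℝ≥0∞)⁻¹ * p (u (τ t)) := by
    filter_upwards [hg] with t ht
    rw [rearrangement_div (by exact_mod_cast hC0), ht, ENNReal.ofReal_coe_nnreal, mul_comm]
    rfl
  have hCi : (C : ℝ≥0∞)⁻¹ ≠ ⊤ := ENNReal.inv_ne_top.2 (by exact_mod_cast hC0.ne')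
  have hmod : scaleModular (complementary φ) μ τ w (fun t => g t / (C : ℝ)) ≤ 1 := by
    calc scaleModular (complementary φ) μ τ w (fun t => g t / (C : ℝ))
        ≤ ∫⁻ t, (C : ℝ≥0∞)⁻¹ * (complementary φ (p (u (τ t))) * w t) ∂μ := by
          refine lintegral_mono_ae ?_
          filter_upwards [hg'] with t ht
          rw [ht, ← mul_assoc]
          gcongr
          exact complementary_mul_le φ (ENNReal.inv_le_one.2 (by exact_mod_cast hC1)) _
      _ = (C : ℝ≥0∞)⁻¹ * A := lintegral_const_mul' _ _ hCi
      _ ≤ (C : ℝ≥0∞)⁻¹ * C := by gcongr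
      _ ≤ 1 := ENNReal.inv_mul_le_one _
  have hnorm : ∫⁻ t, (l * (C : ℝ≥0∞)⁻¹) * (u (τ t) * p (u (τ t)) * w t) ∂μ ≤ l := by
    refine le_trans ?_ hf
    refine le_trans (lintegral_mono_ae ?_) (le_iSup_of_le (fun t => g t / (C : ℝ))
      (le_iSup_of_le (hgm.div_const _) (le_iSup_of_le hmod le_rfl)))
    filter_upwards [hg'] with t ht
    rw [ht]
    calc (l * (C : ℝ≥0∞)⁻¹) * (u (τ t) * p (u (τ t)) * w t)
        = (l * u (τ t)) * ((C : ℝ≥0∞)⁻¹ * p (u (τ t))) * w t := by ring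
      _ ≤ _ := by gcongr; exact huf _
  have hlC : (l : ℝ≥0∞) * (C : ℝ≥0∞)⁻¹ ≠ ⊤ := ENNReal.mul_ne_top ENNReal.coe_ne_top hCi
  rw [lintegral_const_mul' _ _ hlC, mul_assoc] at hnorm
  have hup : ∫⁻ t, u (τ t) * p (u (τ t)) * w t ∂μ ≤ C := by
    have h1 := (ENNReal.mul_le_iff_le_inv (by exact_mod_cast hl) ENNReal.coe_ne_top).1 hnorm
    rw [ENNReal.inv_mul_cancel (by exact_mod_cast hl) ENNReal.coe_ne_top,
      ENNReal.mul_le_iff_le_inv (by simp) hCi] at h1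
    simpa using h1
  have hsum : ∫⁻ t, φ (u (τ t)) * w t ∂μ + A ≤ 1 + A := by
    calc ∫⁻ t, φ (u (τ t)) * w t ∂μ + A
        = ∫⁻ t, φ (u (τ t)) * w t + complementary φ (p (u (τ t))) * w t ∂μ := by
          rw [lintegral_add_right' _ (S.aemeasurable_mul hcm)]
      _ ≤ ∫⁻ t, u (τ t) * p (u (τ t)) * w t ∂μ := by
          refine lintegral_mono fun t => ?_
          dsimp only
          rw [← add_mul]
          gcongr
          exact hpY _
      _ ≤ C := hup
      _ ≤ 1 + A := by
          rw [hC, ENNReal.coe_max, ENNReal.coe_toNNReal hAt]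
          exact max_le le_self_add le_add_self
  exact (ENNReal.add_le_add_iff_right hAt).1 hsum

/-- Cutting `f^* / l` off at height `k` and index `k` gives functions to which
`lintegral_extend_le_one` applies; they increase to `f^* / l` at finite indices, and monotone
convergence concludes. -/
theorem modular_div_le_one (S : IsRearrangementScale μ τ w) (hφ : IsOrlicz φ) {f : α → ℝ}
    {l : ℝ≥0} (hl : l ≠ 0) (hf : scaleOrliczNorm φ μ τ w f ≤ l) :
    scaleModular (extend φ) μ τ w (fun t => f t / (l : ℝ)) ≤ 1 := by
  set x : ℝ≥0∞ → ℝ≥0∞ := rearrangement μ (fun t => f t / (l : ℝ)) with hx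
  have hxa : Antitone x := rearrangement_anti μ _
  set v : ℕ → ℝ≥0∞ → ℝ≥0∞ := fun k t => if t ≤ k then min (x t) k else 0 with hv
  have hvt : ∀ k t, v k t ≠ ⊤ := fun k t => by
    simp only [hv]
    split_ifs
    · exact ne_top_of_le_ne_top (ENNReal.natCast_ne_top k) (min_le_right _ _)
    · exact ENNReal.zero_ne_top
  have hva : ∀ k, Antitone (v k) := fun k s t hst => by
    simp only [hv]
    split_ifs with h1 h2 h2
    · exact min_le_min_right _ (hxa hst)
    · exact absurd (hst.trans h1) h2
    · exact zero_le
    · exact le_rfl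
  have hvm : ∀ t, Monotone fun k => v k t := fun t j k hjk => by
    have hjk' : (j : ℝ≥0∞) ≤ k := by exact_mod_cast hjk
    simp only [hv]
    split_ifs with h1 h2 h2
    · exact min_le_min_left _ hjk'
    · exact absurd (h1.trans hjk') h2
    · exact zero_le
    · exact le_rfl
  have hvx : ∀ k t, v k t ≤ x t := fun k t => by
    simp only [hv]
    split_ifs
    · exact min_le_left _ _
    · exact zero_le
  have hsup : ∀ t, t ≠ ⊤ → extend φ (x t) ≤ ⨆ k, extend φ (v k t) := fun t ht => by
    obtain ⟨k₀, hk₀⟩ := ENNReal.exists_nat_gt ht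
    refine (hφ.iSup_extend_min _).trans (iSup_le fun k => le_iSup_of_le (max k k₀) ?_)
    have h1 : t ≤ ((max k k₀ : ℕ) : ℝ≥0∞) := hk₀.le.trans (by exact_mod_cast le_max_right k k₀)
    simp only [hv, if_pos h1]
    exact hφ.extend_mono (min_le_min_left _ (by exact_mod_cast le_max_left k k₀))
  calc scaleModular (extend φ) μ τ w (fun t => f t / (l : ℝ))
      ≤ ∫⁻ t, ⨆ k, extend φ (v k (τ t)) * w t ∂μ := by
        refine lintegral_mono fun t => ?_
        dsimp only
        rw [← ENNReal.iSup_mul]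
        gcongr
        exact hsup _ (S.index_ne_top t)
    _ = ⨆ k, ∫⁻ t, extend φ (v k (τ t)) * w t ∂μ := by
        refine lintegral_iSup' (fun k => S.aemeasurable_mul
          (hφ.extend_mono.comp_antitone (hva k))) (Eventually.of_forall fun t j k hjk => ?_)
        dsimp only
        gcongr
        exact hφ.extend_mono (hvm _ hjk)
    _ ≤ 1 := by
        refine iSup_le fun k => ?_
        have h1 := S.lintegral_extend_le_one hφ hl hf (u := fun t => (v k t).toNNReal)
          (fun s t hst => ENNReal.toNNReal_mono (hvt k s) (hva k hst)) (c := k)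
          (ENNReal.natCast_ne_top k) (fun t ht => by simp [hv, not_le.2 ht]) (fun t => by
            rw [ENNReal.coe_toNNReal (hvt k t)]
            refine (mul_le_mul_right (hvx k t) _).trans ?_
            rw [hx, rearrangement_div (by exact_mod_cast pos_iff_ne_zero.2 hl),
              ENNReal.ofReal_coe_nnreal]
            exact ENNReal.mul_div_le)
        refine le_trans (le_of_eq ?_) h1
        simp only [← extend_coe φ, ENNReal.coe_toNNReal (hvt k _)]

theorem luxemburgNorm_le_orliczNorm (S : IsRearrangementScale μ τ w) (hφ : IsOrlicz φ)
    (f : α → ℝ) :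
    luxemburgNorm (scaleModular (extend φ) μ τ w) f ≤ scaleOrliczNorm φ μ τ w f := by
  refine le_of_forall_gt_imp_ge_of_dense fun b hb => ?_
  rcases eq_or_ne b ⊤ with rfl | hb'
  · exact le_top
  lift b to ℝ≥0 using hb'
  have hb0 : b ≠ 0 := by rintro rfl; simp at hb
  refine iInf_le_of_le (b : ℝ) (iInf_le_of_le (by exact_mod_cast pos_iff_ne_zero.2 hb0)
    (iInf_le_of_le (S.modular_div_le_one hφ hb0 hb.le) ?_))
  simp

/-- If the functions `h n` arise from `f` by removing bounded parts of finite support, and if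
their rearrangements tend to zero, then both norms of `h n` tend to `θ(f)`. -/
theorem tendsto_norms (S : IsRearrangementScale μ τ w) (hφ : IsOrlicz φ) {f : α → ℝ}
    {h : ℕ → α → ℝ}
    (hf : ∃ l : ℝ, 0 < l ∧ scaleModular (extend φ) μ τ w (fun t => l * f t) < ⊤)
    (hle : ∀ n t, |h n t| ≤ |f t|)
    (hdist : (∀ s, 0 < s → distribution μ f s < ⊤) → ∀ n, 1 ≤ n → ∃ (c : ℝ≥0∞) (M : ℝ), c ≠ ⊤ ∧
      0 ≤ M ∧ (∀ s, 0 < s → distribution μ f s ≤ distribution μ (h n) s + c) ∧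
      ∀ s, M ≤ s → distribution μ f s ≤ distribution μ (h n) s)
    (hlim : (∀ s, 0 < s → distribution μ f s < ⊤) →
      ∀ᵐ t ∂μ, Tendsto (fun n => rearrangement μ (h n) (τ t)) atTop (𝓝 0)) :
    theta (scaleModular (extend φ) μ τ w) f < ⊤ ∧
    (∀ n : ℕ, 1 ≤ n → luxemburgNorm (scaleModular (extend φ) μ τ w) (h n) < ⊤ ∧
      scaleOrliczNorm φ μ τ w (h n) < ⊤) ∧
    Tendsto (fun n => luxemburgNorm (scaleModular (extend φ) μ τ w) (h n)) atTop
      (𝓝 (theta (scaleModular (extend φ) μ τ w) f)) ∧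
    Tendsto (fun n => scaleOrliczNorm φ μ τ w (h n)) atTop
      (𝓝 (theta (scaleModular (extend φ) μ τ w) f)) := by
  obtain ⟨l₀, hl₀, hfl⟩ := hf
  have hdiv₀ : scaleModular (extend φ) μ τ w (fun t => f t / l₀⁻¹) < ⊤ := by
    simpa only [div_inv_eq_mul, mul_comm] using hfl
  have hd : ∀ s, 0 < s → distribution μ f s < ⊤ := fun s hs => by
    have h1 := S.distribution_lt_top hφ hfl (mul_pos hl₀ hs)
    simpa only [distribution, abs_mul, abs_of_pos hl₀, mul_lt_mul_iff_right₀ hl₀] using h1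
  have hθ : theta (scaleModular (extend φ) μ τ w) f < ⊤ :=
    lt_of_le_of_lt (iInf_le_of_le l₀⁻¹ (iInf_le_of_le (inv_pos.2 hl₀) (iInf_le _ hdiv₀)))
      ENNReal.ofReal_lt_top
  have hmono : ∀ (l : ℝ) (n : ℕ), 0 < l → scaleModular (extend φ) μ τ w (fun t => h n t / l) ≤
      scaleModular (extend φ) μ τ w (fun t => f t / l) := fun l n hl =>
    scaleModular_mono hφ.extend_mono fun t => by
      simp only [abs_div]
      exact div_le_div_of_nonneg_right (hle n t) (abs_nonneg l)
  have hO : ∀ n, scaleOrliczNorm φ μ τ w (h n) < ⊤ := fun n =>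
    (S.orliczNorm_le hφ (h n) (inv_pos.2 hl₀)).trans_lt
      (ENNReal.mul_lt_top ENNReal.ofReal_lt_top (ENNReal.add_lt_top.2
        ⟨(hmono _ n (inv_pos.2 hl₀)).trans_lt hdiv₀, ENNReal.one_lt_top⟩))
  have hLO := fun n => S.luxemburgNorm_le_orliczNorm hφ (h n)
  have hθL : ∀ᶠ n in atTop, theta (scaleModular (extend φ) μ τ w) f ≤
      luxemburgNorm (scaleModular (extend φ) μ τ w) (h n) := by
    filter_upwards [eventually_ge_atTop 1] with n hn
    obtain ⟨c, M, hc, hM, h1, h2⟩ := hdist hd n hn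
    exact (S.theta_le_theta hφ hc hM h1 h2).trans (theta_le_luxemburgNorm _ _)
  have hOt : Tendsto (fun n => scaleOrliczNorm φ μ τ w (h n)) atTop
      (𝓝 (theta (scaleModular (extend φ) μ τ w) f)) := by
    refine tendsto_order.2 ⟨fun a ha => ?_, fun a ha => ?_⟩
    · filter_upwards [hθL] with n hn using ha.trans_le (hn.trans (hLO n))
    · obtain ⟨l, hl⟩ := iInf_lt_iff.1 ha
      obtain ⟨hl0, hl⟩ := iInf_lt_iff.1 hl
      obtain ⟨hl1, hl⟩ := iInf_lt_iff.1 hl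
      -- Dominated convergence; the majorant is integrable because `l` is admissible for `f`.
      have hρ : Tendsto (fun n => scaleModular (extend φ) μ τ w (fun t => h n t / l)) atTop
          (𝓝 0) := by
        rw [← lintegral_zero (μ := μ)]
        refine tendsto_lintegral_of_dominated_convergence'
          (fun t => extend φ (rearrangement μ (fun t => f t / l) (τ t)) * w t)
          (fun n => S.aemeasurable_modular hφ.extend_mono _) (fun n => ?_) hl1.ne ?_
        · refine Eventually.of_forall fun t => ?_
          dsimp only
          gcongr
          refine hφ.extend_mono (rearrangement_mono (fun t => ?_) _)
          simp only [abs_div]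
          exact div_le_div_of_nonneg_right (hle n t) (abs_nonneg l)
        · filter_upwards [hlim hd] with t ht
          have h1 : Tendsto (fun n => rearrangement μ (h n) (τ t) / ENNReal.ofReal l) atTop
              (𝓝 0) := by
            simpa using ENNReal.Tendsto.div_const ht (Or.inr (by simpa using hl0))
          have h2 := ENNReal.Tendsto.mul_const (b := w t) (hφ.extend_tendsto_zero.comp h1)
            (Or.inr (S.weight_ne_top t))
          simpa only [rearrangement_div hl0, zero_mul, Function.comp_def] using h2
      have hb : Tendsto (fun n => ENNReal.ofReal l *
          (scaleModular (extend φ) μ τ w (fun t => h n t / l) + 1)) atTop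
          (𝓝 (ENNReal.ofReal l)) := by
        simpa using ENNReal.Tendsto.const_mul (a := ENNReal.ofReal l)
          (hρ.add (tendsto_const_nhds (x := (1 : ℝ≥0∞)))) (Or.inr ENNReal.ofReal_ne_top)
      filter_upwards [hb.eventually_lt_const hl] with n hn using
        (S.orliczNorm_le hφ (h n) hl0).trans_lt hn
  exact ⟨hθ, fun n _ => ⟨(hLO n).trans_lt (hO n), hO n⟩,
    tendsto_of_tendsto_of_tendsto_of_le_of_le' tendsto_const_nhds hOt hθL
      (Eventually.of_forall hLO), hOt⟩

end IsRearrangementScale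

end Abstract

end OrliczLorentz

end

namespace OrliczLorentz

/-! ### Function spaces on `[0, γ)` -/

section Interval

theorem measurableSet_interval (γ : ℝ≥0∞) : MeasurableSet (interval γ) :=
  measurableSet_Ici.inter (ENNReal.measurable_ofReal measurableSet_Iio)

/-- The origin is a null set, and the weight is uncontrolled there. -/
theorem intervalMeasure_eq (γ : ℝ≥0∞) :
    intervalMeasure γ = volume.restrict (interval γ ∩ Ioi 0) := by
  refine Measure.restrict_congr_set ?_
  have h : ∀ᵐ t : ℝ, t ≠ 0 := by simp [ae_iff]
  filter_upwards [h] with t ht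
  refine propext ⟨fun h => ⟨h, lt_of_le_of_ne h.1 ht.symm⟩, fun h => h.1⟩

theorem exists_mem_interval {γ : ℝ≥0∞} (hγ : 0 < γ) : ∃ t ∈ interval γ, 0 < t := by
  obtain ⟨r, hr0, hr⟩ := ENNReal.lt_iff_exists_nnreal_btwn.1 hγ
  exact ⟨r, ⟨r.2, by simpa using hr⟩, by exact_mod_cast hr0⟩

theorem intervalMeasure_Icc {γ : ℝ≥0∞} {t : ℝ} (ht : t ∈ interval γ) :
    intervalMeasure γ (Icc 0 t) = ENNReal.ofReal t := by
  rw [intervalMeasure, Measure.restrict_apply measurableSet_Icc, inter_eq_left.2, Real.volume_Icc,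
    sub_zero]
  exact fun x hx => ⟨hx.1, (ENNReal.ofReal_le_ofReal hx.2).trans_lt ht.2⟩

theorem intervalMeasure_Iio_le (γ : ℝ≥0∞) (t : ℝ) :
    intervalMeasure γ (Iio t) ≤ ENNReal.ofReal t := by
  rw [intervalMeasure, Measure.restrict_apply measurableSet_Iio]
  calc volume (Iio t ∩ interval γ) ≤ volume (Ico 0 t) :=
        measure_mono fun x hx => ⟨hx.2.1, hx.1⟩
    _ = ENNReal.ofReal t := by rw [Real.volume_Ico, sub_zero]

/-- A monotone function is discontinuous at only countably many points, and at a continuity point it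
agrees with its rearrangement. -/
theorem rearrangement_of_antitone (γ : ℝ≥0∞) {G : ℝ≥0∞ → ℝ≥0} (hG : Antitone G) :
    ∀ᵐ t ∂(intervalMeasure γ), rearrangement (intervalMeasure γ)
      (fun t => (G (ENNReal.ofReal t) : ℝ)) (ENNReal.ofReal t) = G (ENNReal.ofReal t) := by
  have hGa : Antitone fun t : ℝ => G (ENNReal.ofReal t) :=
    hG.comp_monotone fun _ _ h => ENNReal.ofReal_le_ofReal h
  have h1 : ∀ᵐ t ∂(intervalMeasure γ), ContinuousAt (fun t : ℝ => G (ENNReal.ofReal t)) t := by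
    refine ae_restrict_of_ae ?_
    rw [ae_iff]
    exact hGa.countable_not_continuousAt.measure_zero _
  have h2 : ∀ᵐ t ∂(intervalMeasure γ), t ∈ interval γ :=
    ae_restrict_mem (measurableSet_interval γ)
  filter_upwards [h1, h2] with t ht htI
  apply le_antisymm
  · refine (rearrangement_le (s := G (ENNReal.ofReal t)) (NNReal.coe_nonneg _) ?_).trans (by simp)
    refine (measure_mono fun x hx => ?_).trans (intervalMeasure_Iio_le γ t)
    by_contra hxt
    have h3 := hGa (not_lt.1 hxt)
    simp only [mem_ofPred_eq, NNReal.abs_eq, NNReal.coe_lt_coe] at hx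
    exact (hx.trans_le h3).false
  · refine le_of_forall_lt fun b hb => ?_
    obtain ⟨a, hba, ha⟩ := ENNReal.lt_iff_exists_nnreal_btwn.1 hb
    refine hba.trans_le ?_
    -- Continuity carries the bound `a < G` to some `x > t`. The level set then contains `[0, x]`,
    -- whose measure strictly exceeds `t`.
    have hev : ∀ᶠ x in 𝓝 t, a < G (ENNReal.ofReal x) ∧ ENNReal.ofReal x < γ :=
      (ht.eventually_const_lt (by exact_mod_cast ha)).and
        (ENNReal.continuous_ofReal.continuousAt.eventually_lt_const htI.2)
    obtain ⟨x, ⟨hx1, hx2⟩, hx3⟩ :=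
      ((hev.filter_mono nhdsWithin_le_nhds).and (self_mem_nhdsWithin (s := Ioi t))).exists
    have hx0 : 0 < x := htI.1.trans_lt hx3
    have h3 : ENNReal.ofReal (a : ℝ) ≤ rearrangement (intervalMeasure γ)
        (fun t => (G (ENNReal.ofReal t) : ℝ)) (ENNReal.ofReal t) := by
      refine le_rearrangement ?_
      calc ENNReal.ofReal t < ENNReal.ofReal x := (ENNReal.ofReal_lt_ofReal_iff hx0).2 hx3
        _ = intervalMeasure γ (Icc 0 x) := (intervalMeasure_Icc ⟨hx0.le, hx2⟩).symm
        _ ≤ _ := measure_mono fun y hy => by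
          simp only [mem_ofPred_eq, NNReal.abs_eq, NNReal.coe_lt_coe]
          exact hx1.trans_le (hGa hy.2)
    simpa using h3

theorem IsWeight.isRearrangementScale {γ : ℝ≥0∞} {w : ℝ → ℝ} (hγ : 0 < γ) (hw : IsWeight γ w) :
    IsRearrangementScale (intervalMeasure γ) ENNReal.ofReal (fun t => ENNReal.ofReal (w t)) where
  measurable_index := ENNReal.measurable_ofReal
  index_ne_top _ := ENNReal.ofReal_ne_top
  weight_ne_top _ := ENNReal.ofReal_ne_top
  aemeasurable_weight := by
    rw [intervalMeasure_eq]
    exact (aemeasurable_restrict_of_antitoneOn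
      ((measurableSet_interval γ).inter measurableSet_Ioi) hw.anti).ennreal_ofReal
  total h := by
    have hγt : γ = ⊤ := by
      by_contra hne
      rw [intervalMeasure, Measure.restrict_apply_univ] at h
      have h1 : volume (interval γ) ≤ volume (Icc 0 γ.toReal) := measure_mono fun x hx =>
        ⟨hx.1, (ENNReal.ofReal_le_iff_le_toReal hne).1 hx.2.le⟩
      rw [h, Real.volume_Icc, top_le_iff] at h1
      exact ENNReal.ofReal_ne_top h1
    rw [intervalMeasure_eq, ← hw.total hγt]
    congr 2
    ext t
    simp only [interval, hγt, mem_inter_iff, mem_ofPred_eq, mem_Ioi]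
    exact ⟨fun h => h.2, fun h => ⟨⟨h.le, ENNReal.ofReal_lt_top⟩, h⟩⟩
  head c hc := by
    obtain ⟨t₀, ht₀, ht₀'⟩ := exists_mem_interval hγ
    have hset : MeasurableSet {t : ℝ | ENNReal.ofReal t ≤ c} :=
      ENNReal.measurable_ofReal measurableSet_Iic
    rw [intervalMeasure_eq, Measure.restrict_restrict hset]
    set A : Set ℝ := {t : ℝ | ENNReal.ofReal t ≤ c} ∩ (interval γ ∩ Ioi 0) with hA
    have hAm : MeasurableSet A :=
      hset.inter ((measurableSet_interval γ).inter measurableSet_Ioi)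
    -- Up to `t₀` local integrability applies; beyond it `w ≤ w t₀` on a set of finite measure.
    have hsub : A ⊆ Ioc 0 t₀ ∪ (A ∩ Ioi t₀) := fun x hx => by
      rcases le_or_gt x t₀ with h | h
      · exact Or.inl ⟨hx.2.2, h⟩
      · exact Or.inr ⟨hx, h⟩
    refine (lintegral_mono_set hsub).trans_lt ((lintegral_union_le _ _ _).trans_lt
      (ENNReal.add_lt_top.2 ⟨?_, ?_⟩))
    · have h1 := (hw.locInt t₀ ht₀).2
      refine lt_of_le_of_lt (lintegral_mono fun t => ?_) h1
      exact Real.ofReal_le_enorm _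
    · calc ∫⁻ t in A ∩ Ioi t₀, ENNReal.ofReal (w t)
          ≤ ∫⁻ _ in A ∩ Ioi t₀, ENNReal.ofReal (w t₀) := by
            refine setLIntegral_mono' (hAm.inter measurableSet_Ioi) fun x hx => ?_
            exact ENNReal.ofReal_le_ofReal (hw.anti ⟨ht₀, ht₀'⟩ hx.1.2 (mem_Ioi.1 hx.2).le)
        _ = ENNReal.ofReal (w t₀) * volume (A ∩ Ioi t₀) := setLIntegral_const _ _
        _ < ⊤ := by
            refine ENNReal.mul_lt_top ENNReal.ofReal_lt_top ?_
            refine (measure_mono (t := Icc 0 c.toReal) fun x hx => ?_).trans_lt measure_Icc_lt_top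
            exact ⟨hx.1.2.1.1, (ENNReal.ofReal_le_iff_le_toReal hc).1 hx.1.1⟩
  tail c F G hc hF hG hFG := by
    have hset : MeasurableSet {t : ℝ | c < ENNReal.ofReal t} :=
      ENNReal.measurable_ofReal measurableSet_Ioi
    have hJ : MeasurableSet (interval γ ∩ Ioi 0) :=
      (measurableSet_interval γ).inter measurableSet_Ioi
    -- Both sides become integrals over the whole line, and the right one is translated by `c`.
    rw [intervalMeasure_eq, Measure.restrict_restrict hset, ← lintegral_indicator hJ,
      ← lintegral_indicator (hset.inter hJ),
      ← lintegral_sub_right_eq_self ((interval γ ∩ Ioi 0).indicator _) c.toReal]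
    refine lintegral_mono fun t => indicator_apply_le' (fun ht => ?_) fun _ => zero_le
    obtain ⟨ht1, ht2, ht3⟩ := ht
    have hct : c.toReal < t := (ENNReal.lt_ofReal_iff_toReal_lt hc).1 ht1
    have hle : t - c.toReal ≤ t := sub_le_self _ ENNReal.toReal_nonneg
    have hmem : t - c.toReal ∈ interval γ ∩ Ioi 0 :=
      ⟨⟨(sub_pos.2 hct).le, (ENNReal.ofReal_le_ofReal hle).trans_lt ht2.2⟩, sub_pos.2 hct⟩
    rw [indicator_of_mem hmem]
    have e : ENNReal.ofReal t = ENNReal.ofReal (t - c.toReal) + c := by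
      nth_rw 2 [← ENNReal.ofReal_toReal hc]
      rw [← ENNReal.ofReal_add (sub_pos.2 hct).le ENNReal.toReal_nonneg, sub_add_cancel]
    refine mul_le_mul' ?_ (ENNReal.ofReal_le_ofReal (hw.anti hmem ⟨ht2, ht3⟩ hle))
    rw [e]
    exact hFG _
  realize G hG := ⟨fun t => (G (ENNReal.ofReal t) : ℝ),
    (hG.measurable.comp ENNReal.measurable_ofReal).coe_nnreal_real.aemeasurable,
    rearrangement_of_antitone γ hG⟩

theorem sub_truncation_of_mem {f : ℝ → ℝ} {n : ℕ} {t : ℝ} (h : 1 / (n : ℝ) ≤ |f t| ∧ |f t| ≤ n) :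
    (f - truncation f n) t = 0 := by
  rw [Pi.sub_apply, truncation, indicator_of_mem (by exact h), sub_self]

theorem sub_truncation_of_notMem {f : ℝ → ℝ} {n : ℕ} {t : ℝ}
    (h : ¬ (1 / (n : ℝ) ≤ |f t| ∧ |f t| ≤ n)) : (f - truncation f n) t = f t := by
  rw [Pi.sub_apply, truncation, indicator_of_notMem (by exact h), sub_zero]

theorem abs_sub_truncation_le (f : ℝ → ℝ) (n : ℕ) (t : ℝ) :
    |(f - truncation f n) t| ≤ |f t| := by
  by_cases h : 1 / (n : ℝ) ≤ |f t| ∧ |f t| ≤ n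
  · simp [sub_truncation_of_mem h]
  · rw [sub_truncation_of_notMem h]

theorem distribution_le_sub_truncation_add {μ : Measure ℝ} {f : ℝ → ℝ} {n : ℕ} (hn : 1 ≤ n)
    (s : ℝ) : distribution μ f s ≤
      distribution μ (f - truncation f n) s + distribution μ f (1 / (2 * n)) := by
  have hn' : (0 : ℝ) < n := by exact_mod_cast hn
  refine (measure_mono fun t ht => ?_).trans (measure_union_le _ _)
  by_cases h : 1 / (n : ℝ) ≤ |f t| ∧ |f t| ≤ n
  -- On the removed part `|f| ≥ 1 / n`; halving this level gives the strict inequality required by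
  -- `distribution`.
  · right
    refine lt_of_lt_of_le ?_ h.1
    gcongr
    linarith
  · left
    rwa [mem_ofPred_eq, sub_truncation_of_notMem h]

theorem distribution_le_sub_truncation {μ : Measure ℝ} {f : ℝ → ℝ} {n : ℕ} {s : ℝ}
    (hs : (n : ℝ) ≤ s) : distribution μ f s ≤ distribution μ (f - truncation f n) s := by
  refine measure_mono fun t ht => ?_
  rw [mem_ofPred_eq] at ht ⊢
  rwa [sub_truncation_of_notMem fun h => (ht.trans_le (h.2.trans hs)).false]

theorem tendsto_distribution_zero {μ : Measure ℝ} {f : ℝ → ℝ} (hf : AEMeasurable f μ)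
    (hd : ∀ s, 0 < s → distribution μ f s < ⊤) :
    Tendsto (fun n : ℕ => distribution μ f n) atTop (𝓝 0) := by
  have h := tendsto_measure_iInter_atTop (μ := μ) (s := fun n : ℕ => {t | (n : ℝ) < |f t|})
    (fun n => nullMeasurableSet_lt aemeasurable_const (by simpa using hf.norm))
    (fun m n hmn t (ht : (n : ℝ) < |f t|) =>
      show (m : ℝ) < |f t| from lt_of_le_of_lt (by exact_mod_cast hmn) ht)
    ⟨1, by simpa [distribution] using (hd 1 one_pos).ne⟩
  have he : ⋂ n : ℕ, {t | (n : ℝ) < |f t|} = ∅ := by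
    refine eq_empty_of_forall_notMem fun t ht => ?_
    obtain ⟨n, hn⟩ := exists_nat_gt |f t|
    exact (hn.trans (mem_iInter.1 ht n)).false
  rwa [he, measure_empty] at h

/-- Once `1 / n < s`, the difference exceeds `s` only where `|f| > n`. The measure of that set tends
to `0`, so it eventually drops below `t > 0`. -/
theorem tendsto_rearrangement_sub_truncation {μ : Measure ℝ} {f : ℝ → ℝ} (hf : AEMeasurable f μ)
    (hd : ∀ s, 0 < s → distribution μ f s < ⊤) {t : ℝ≥0∞} (ht : 0 < t) :
    Tendsto (fun n => rearrangement μ (f - truncation f n) t) atTop (𝓝 0) := by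
  refine ENNReal.tendsto_nhds_zero.2 fun ε hε => ?_
  obtain ⟨s, hs0, hs⟩ := ENNReal.lt_iff_exists_nnreal_btwn.1 hε
  have hs0' : (0 : ℝ) < s := by exact_mod_cast hs0
  have h1 : ∀ᶠ n : ℕ in atTop, 1 / (n : ℝ) < s :=
    tendsto_one_div_atTop_nhds_zero_nat.eventually_lt_const hs0'
  filter_upwards [h1, (tendsto_distribution_zero hf hd).eventually_lt_const ht] with n hn1 hn2
  have h2 : rearrangement μ (f - truncation f n) t ≤ ENNReal.ofReal (s : ℝ) := by
    refine rearrangement_le hs0'.le (le_trans (measure_mono fun x hx => ?_) hn2.le)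
    rw [mem_ofPred_eq] at hx ⊢
    by_cases h : 1 / (n : ℝ) ≤ |f x| ∧ |f x| ≤ n
    · rw [sub_truncation_of_mem h, abs_zero] at hx
      exact absurd hx hs0'.not_gt
    · rw [sub_truncation_of_notMem h] at hx
      exact not_le.1 fun h' => h ⟨(hn1.trans hx).le, h'⟩
  rw [ENNReal.ofReal_coe_nnreal] at h2
  exact h2.trans hs.le

end Interval

/-! ### Sequence spaces -/

section Sequence

theorem seqModular_eq (Φ : ℝ≥0∞ → ℝ≥0∞) (w : ℕ → ℝ) :
    seqModular Φ w = scaleModular Φ Measure.count (fun i : ℕ => (i : ℝ≥0∞))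
      (fun i => ENNReal.ofReal (w i)) := by
  funext x
  rw [scaleModular, lintegral_count]
  rfl

theorem seqOrliczNorm_eq (φ : ℝ≥0 → ℝ≥0) (w : ℕ → ℝ) :
    seqOrliczNorm φ w = scaleOrliczNorm φ Measure.count (fun i : ℕ => (i : ℝ≥0∞))
      (fun i => ENNReal.ofReal (w i)) := by
  funext x
  simp only [seqOrliczNorm, scaleOrliczNorm, seqModular_eq, lintegral_count]
  refine iSup_congr fun y => ?_
  rw [iSup_pos (measurable_of_countable y).aemeasurable]
  rfl

theorem count_Iio_nat (n : ℕ) : Measure.count (Iio n) = (n : ℝ≥0∞) := by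
  rw [← Finset.coe_Iio, Measure.count_apply_finset, Nat.card_Iio]

theorem seqRearrangement_of_antitone {G : ℝ≥0∞ → ℝ≥0} (hG : Antitone G) (i : ℕ) :
    rearrangement Measure.count (fun j : ℕ => (G j : ℝ)) i = G i := by
  have hGa : Antitone fun j : ℕ => G j := hG.comp_monotone fun _ _ h => by exact_mod_cast h
  apply le_antisymm
  · refine (rearrangement_le (s := G i) (NNReal.coe_nonneg _) ?_).trans (by simp)
    refine (measure_mono fun j hj => ?_).trans (count_Iio_nat i).le
    by_contra hij
    simp only [mem_ofPred_eq, NNReal.abs_eq, NNReal.coe_lt_coe] at hj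
    exact (hj.trans_le (hGa (not_lt.1 hij))).false
  · refine le_of_forall_lt fun b hb => ?_
    obtain ⟨a, hba, ha⟩ := ENNReal.lt_iff_exists_nnreal_btwn.1 hb
    refine hba.trans_le ?_
    have h3 : ENNReal.ofReal (a : ℝ) ≤
        rearrangement Measure.count (fun j : ℕ => (G j : ℝ)) (i : ℝ≥0∞) := by
      refine le_rearrangement ?_
      -- The terms with indices `0, …, i` number `i + 1`, which yields the strict inequality; no
      -- exceptional indices arise here.
      calc (i : ℝ≥0∞) < ((i + 1 : ℕ) : ℝ≥0∞) := by exact_mod_cast i.lt_succ_self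
        _ = Measure.count (Iio (i + 1)) := (count_Iio_nat _).symm
        _ ≤ _ := measure_mono fun j hj => by
          simp only [mem_ofPred_eq, NNReal.abs_eq, NNReal.coe_lt_coe]
          exact lt_of_lt_of_le (by exact_mod_cast ha) (hGa (Nat.lt_succ_iff.1 hj))
    simpa using h3

theorem IsSeqWeight.isRearrangementScale {w : ℕ → ℝ} (hw : IsSeqWeight w) :
    IsRearrangementScale Measure.count (fun i : ℕ => (i : ℝ≥0∞))
      (fun i => ENNReal.ofReal (w i)) where
  measurable_index := measurable_of_countable _
  index_ne_top i := ENNReal.natCast_ne_top i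
  weight_ne_top _ := ENNReal.ofReal_ne_top
  aemeasurable_weight := (measurable_of_countable _).aemeasurable
  total _ := by rw [lintegral_count, hw.total]
  head c hc := by
    obtain ⟨n, hn⟩ := ENNReal.exists_nat_gt hc
    calc ∫⁻ i in {i : ℕ | (i : ℝ≥0∞) ≤ c}, ENNReal.ofReal (w i) ∂Measure.count
        ≤ ∫⁻ _ in {i : ℕ | (i : ℝ≥0∞) ≤ c}, ENNReal.ofReal (w 0) ∂Measure.count :=
          lintegral_mono fun i => ENNReal.ofReal_le_ofReal (hw.anti (zero_le (a := i)))
      _ = ENNReal.ofReal (w 0) * Measure.count {i : ℕ | (i : ℝ≥0∞) ≤ c} := setLIntegral_const _ _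
      _ ≤ ENNReal.ofReal (w 0) * Measure.count (Iio n) := by
          gcongr
          intro i hi
          exact_mod_cast lt_of_le_of_lt hi hn
      _ < ⊤ := by
          rw [count_Iio_nat]
          exact ENNReal.mul_lt_top ENNReal.ofReal_lt_top (ENNReal.natCast_lt_top n)
  tail c F G hc hF hG hFG := by
    lift c to ℝ≥0 using hc
    rw [← lintegral_indicator (MeasurableSet.of_discrete), lintegral_count, lintegral_count,
      -- The shift must be an integer: the terms below `⌈c⌉₊` vanish, and the later ones are
      -- compared after a shift by `⌈c⌉₊ ≥ c`.
      ← ENNReal.summable.sum_add_tsum_nat_add' (k := ⌈c⌉₊), Finset.sum_eq_zero, zero_add]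
    · refine ENNReal.tsum_le_tsum fun i => indicator_apply_le' (fun _ => ?_) fun _ => zero_le
      refine mul_le_mul' ((hF ?_).trans (hFG _))
        (ENNReal.ofReal_le_ofReal (hw.anti (Nat.le_add_right _ _)))
      push_cast
      gcongr
      exact_mod_cast Nat.le_ceil c
    · intro i hi
      refine indicator_of_notMem (fun h => ?_) _
      have h1 : c < i := by exact_mod_cast (show (c : ℝ≥0∞) < i from h)
      exact (Finset.mem_range.1 hi).not_ge (Nat.ceil_le.2 h1.le)
  realize G hG := ⟨fun i => (G i : ℝ), (measurable_of_countable _).aemeasurable,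
    Eventually.of_forall fun i => seqRearrangement_of_antitone hG i⟩

theorem sub_seqTruncation_of_lt (x : ℕ → ℝ) {n i : ℕ} (h : i < n) :
    (x - seqTruncation x n) i = 0 := by
  rw [Pi.sub_apply, seqTruncation, indicator_of_mem (by exact h), sub_self]

theorem sub_seqTruncation_of_le (x : ℕ → ℝ) {n i : ℕ} (h : n ≤ i) :
    (x - seqTruncation x n) i = x i := by
  rw [Pi.sub_apply, seqTruncation, indicator_of_notMem (by exact not_lt.2 h), sub_zero]

theorem abs_sub_seqTruncation_le (x : ℕ → ℝ) (n i : ℕ) : |(x - seqTruncation x n) i| ≤ |x i| := by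
  rcases lt_or_ge i n with h | h
  · simp [sub_seqTruncation_of_lt x h]
  · rw [sub_seqTruncation_of_le x h]

theorem distribution_le_sub_seqTruncation_add (x : ℕ → ℝ) (n : ℕ) (s : ℝ) :
    distribution Measure.count x s ≤ distribution Measure.count (x - seqTruncation x n) s + n := by
  rw [← count_Iio_nat]
  refine (measure_mono fun i hi => ?_).trans (measure_union_le _ _)
  rcases lt_or_ge i n with h | h
  · exact Or.inr h
  · left
    rwa [mem_ofPred_eq, sub_seqTruncation_of_le x h]

/-- The sum serves merely as an upper bound for each of the removed terms, so none of them exceeds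
the level `s`. -/
theorem distribution_le_sub_seqTruncation {x : ℕ → ℝ} {n : ℕ} {s : ℝ}
    (hs : ∑ i ∈ Finset.range n, |x i| ≤ s) :
    distribution Measure.count x s ≤ distribution Measure.count (x - seqTruncation x n) s := by
  refine measure_mono fun i hi => ?_
  rw [mem_ofPred_eq] at hi ⊢
  rwa [sub_seqTruncation_of_le x]
  by_contra! hin
  have h1 := Finset.single_le_sum (f := fun i => |x i|) (fun i _ => abs_nonneg (x i))
    (Finset.mem_range.2 hin)
  exact (hi.trans_le (h1.trans hs)).false

/-- Finite level sets mean that `x` tends to `0`, so the tails are eventually at most `s`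
everywhere. -/
theorem tendsto_rearrangement_sub_seqTruncation {x : ℕ → ℝ}
    (hd : ∀ s, 0 < s → distribution Measure.count x s < ⊤) (t : ℝ≥0∞) :
    Tendsto (fun n => rearrangement Measure.count (x - seqTruncation x n) t) atTop (𝓝 0) := by
  refine ENNReal.tendsto_nhds_zero.2 fun ε hε => ?_
  obtain ⟨s, hs0, hs⟩ := ENNReal.lt_iff_exists_nnreal_btwn.1 hε
  have hs0' : (0 : ℝ) < s := by exact_mod_cast hs0
  obtain ⟨N, hN⟩ := (Measure.count_apply_lt_top.1 (hd s hs0')).bddAbove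
  filter_upwards [eventually_gt_atTop N] with n hn
  have h2 : rearrangement Measure.count (x - seqTruncation x n) t ≤ ENNReal.ofReal (s : ℝ) := by
    refine rearrangement_le hs0'.le (le_of_eq_of_le ?_ zero_le)
    rw [distribution, Measure.count_eq_zero_iff]
    refine eq_empty_of_forall_notMem fun i hi => ?_
    rw [mem_ofPred_eq] at hi
    rcases lt_or_ge i n with h | h
    · rw [sub_seqTruncation_of_lt x h, abs_zero] at hi
      exact hi.not_gt hs0'
    · rw [sub_seqTruncation_of_le x h] at hi
      exact (hn.trans_le h).not_ge (hN hi)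
  rw [ENNReal.ofReal_coe_nnreal] at h2
  exact h2.trans hs.le

end Sequence

end OrliczLorentz

/-! ### The theorem for both kinds of spaces -/

theorem mainTheorem6 (φ : ℝ≥0 → ℝ≥0) (hφ : OrliczLorentz.IsOrlicz φ) :
    (∀ (γ : ℝ≥0∞) (w : ℝ → ℝ), 0 < γ → OrliczLorentz.IsWeight γ w →
      ∀ f ∈ OrliczLorentz.functionSpace φ γ w,
        OrliczLorentz.theta (OrliczLorentz.modular (OrliczLorentz.extend φ) γ w) f < ⊤ ∧
        (∀ n : ℕ, 1 ≤ n →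
          OrliczLorentz.luxemburgNorm (OrliczLorentz.modular (OrliczLorentz.extend φ) γ w)
            (f - OrliczLorentz.truncation f n) < ⊤ ∧
          OrliczLorentz.orliczNorm φ γ w (f - OrliczLorentz.truncation f n) < ⊤) ∧
        Tendsto (fun n : ℕ =>
            OrliczLorentz.luxemburgNorm (OrliczLorentz.modular (OrliczLorentz.extend φ) γ w)
              (f - OrliczLorentz.truncation f n)) atTop
          (𝓝 (OrliczLorentz.theta (OrliczLorentz.modular (OrliczLorentz.extend φ) γ w) f)) ∧
        Tendsto (fun n : ℕ =>
            OrliczLorentz.orliczNorm φ γ w (f - OrliczLorentz.truncation f n)) atTop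
          (𝓝 (OrliczLorentz.theta (OrliczLorentz.modular (OrliczLorentz.extend φ) γ w) f))) ∧
    (∀ w : ℕ → ℝ, OrliczLorentz.IsSeqWeight w →
      ∀ x ∈ OrliczLorentz.sequenceSpace φ w,
        OrliczLorentz.theta (OrliczLorentz.seqModular (OrliczLorentz.extend φ) w) x < ⊤ ∧
        (∀ n : ℕ, 1 ≤ n →
          OrliczLorentz.luxemburgNorm (OrliczLorentz.seqModular (OrliczLorentz.extend φ) w)
            (x - OrliczLorentz.seqTruncation x n) < ⊤ ∧
          OrliczLorentz.seqOrliczNorm φ w (x - OrliczLorentz.seqTruncation x n) < ⊤) ∧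
        Tendsto (fun n : ℕ =>
            OrliczLorentz.luxemburgNorm (OrliczLorentz.seqModular (OrliczLorentz.extend φ) w)
              (x - OrliczLorentz.seqTruncation x n)) atTop
          (𝓝 (OrliczLorentz.theta (OrliczLorentz.seqModular (OrliczLorentz.extend φ) w) x)) ∧
        Tendsto (fun n : ℕ =>
            OrliczLorentz.seqOrliczNorm φ w (x - OrliczLorentz.seqTruncation x n)) atTop
          (𝓝 (OrliczLorentz.theta (OrliczLorentz.seqModular (OrliczLorentz.extend φ) w) x))) := by
  refine ⟨fun γ w hγ hw f hf => ?_, fun w hw x hx => ?_⟩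
  · refine (hw.isRearrangementScale hγ).tendsto_norms hφ hf.2
      (OrliczLorentz.abs_sub_truncation_le f) (fun hd n hn => ?_) fun hd => ?_
    · have hn' : (0 : ℝ) < n := by exact_mod_cast hn
      -- The removed part has support of measure at most `d_f(1 / (2n))`, which is finite, and is
      -- bounded by `M = n`.
      exact ⟨_, n, (hd (1 / (2 * n)) (by positivity)).ne, hn'.le,
        fun s _ => OrliczLorentz.distribution_le_sub_truncation_add hn s,
        fun s hs => OrliczLorentz.distribution_le_sub_truncation hs⟩
    · have hpos : ∀ᵐ t ∂(OrliczLorentz.intervalMeasure γ), t ∈ OrliczLorentz.interval γ ∩ Ioi 0 := by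
        rw [OrliczLorentz.intervalMeasure_eq]
        exact ae_restrict_mem
          ((OrliczLorentz.measurableSet_interval γ).inter measurableSet_Ioi)
      filter_upwards [hpos] with t ht
      exact OrliczLorentz.tendsto_rearrangement_sub_truncation hf.1 hd
        (ENNReal.ofReal_pos.2 ht.2)
  · simp only [OrliczLorentz.sequenceSpace, OrliczLorentz.seqModular_eq,
      OrliczLorentz.seqOrliczNorm_eq] at hx ⊢
    exact hw.isRearrangementScale.tendsto_norms hφ hx
      (OrliczLorentz.abs_sub_seqTruncation_le x)
      (fun hd n _ => ⟨n, ∑ i ∈ Finset.range n, |x i|, ENNReal.natCast_ne_top n,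
        Finset.sum_nonneg fun i _ => abs_nonneg (x i),
        fun s _ => OrliczLorentz.distribution_le_sub_seqTruncation_add x n s,
        fun s hs => OrliczLorentz.distribution_le_sub_seqTruncation hs⟩)
      fun hd => Eventually.of_forall fun i =>
        OrliczLorentz.tendsto_rearrangement_sub_seqTruncation hd i
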